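/- **Theorem.** For $x,y\in\mathbb{R}^d$ write $\mathsf{P}^\perp_x y = y-\langle x,y\rangle x$. For $\beta\ge 0$, consider the self-attention dynamics for $n$ particles $x_1(t),\dots,x_n(t)$ on the unit sphere $\mathbb{S}^{d-1}\subset\mathbb{R}^d$: $$\dot x_i(t)=\mathsf{P}^\perp_{x_i(t)}\Big(\frac{1}{Z_{\beta,i}(t)}\sum_{j=1}^n e^{\beta\langle x_i(t),x_j(t)\rangle}x_j(t)\Big),\qquad Z_{\beta,i}(t)=\sum_{k=1}^n e^{\beta\langle x_i(t),x_k(t)\rangle},\qquad t\ge 0,\ i=1,\dots,n. \tag{SA}$$ Fix $\beta\ge 0$ and an integer $n\ge 2$. The scalar Cauchy problem $$\dot\gamma_\beta(t)=\frac{2e^{\beta\gamma_\beta(t)}(1-\gamma_\beta(t))\big((n-1)\gamma_\beta(t)+1\big)}{e^{\beta}+(n-1)e^{\beta\gamma_\beta(t)}}\quad (t\ge 0),\qquad \gamma_\beta(0)=0,$$ has a unique solution $\gamma_\beta$ on $[0,\infty)$. Put $c(\beta)=e^{10\max\{1,\beta\}}$. There exist an integer $d^*=d^*(n,\beta)\ge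 n$ and constants $C=C(n,\beta)>0$ and $\lambda=\lambda(n,\beta)>0$ such that, for every integer $d\ge d^*$, the following holds. For each initial datum in $(\mathbb{S}^{d-1})^n$ the Cauchy problem for (SA) has a unique solution on $[0,\infty)$ with values in $(\mathbb{S}^{d-1})^n$. If the initial points $x_1(0),\dots,x_n(0)$ are i.i.d. and uniformly distributed on $\mathbb{S}^{d-1}$ and $(x_i(\cdot))_{1\le i\le n}$ is the corresponding solution, then, with probability at least $1-2n^2d^{-1/64}$, $$\big|\langle x_i(t),x_j(t)\rangle-\gamma_\beta(t)\big|\le\min\Big\{2\,c(\beta)^{nt}\sqrt{\tfrac{\log d}{d}},\ Ce^{-\lambda t}\Big\}\qquad\text{for all } i\ne j \text{ and all } t\ge 0 .$$ -/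

import Mathlib

open MeasureTheory ProbabilityTheory

noncomputable section

/-- The unit sphere `S^{d-1}` of `ℝ^d`. -/
abbrev UnitSphere (d : ℕ) : Type :=
  Metric.sphere (0 : EuclideanSpace ℝ (Fin d)) 1

/-- The uniform probability measure on `S^{d-1}`: the normalized surface measure. -/
def uniformSphere (d : ℕ) : Measure (UnitSphere d) :=
  ((volume : Measure (EuclideanSpace ℝ (Fin d))).toSphere Set.univ)⁻¹ •
    (volume : Measure (EuclideanSpace ℝ (Fin d))).toSphere

/-- `P^⊥_x y = y - ⟨x, y⟩ x`, for unit `x` the orthogonal projection of `y` onto the tangent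
space of the sphere at `x`. -/
def tangentProj {d : ℕ} (x y : EuclideanSpace ℝ (Fin d)) : EuclideanSpace ℝ (Fin d) :=
  y - inner ℝ x y • x

/-- The partition function `Z_{β,i} = ∑_k exp (β ⟨x_i, x_k⟩)`. -/
def partitionFn {n d : ℕ} (β : ℝ) (x : Fin n → EuclideanSpace ℝ (Fin d)) (i : Fin n) : ℝ :=
  ∑ k, Real.exp (β * inner ℝ (x i) (x k))

/-- The velocity of the `i`-th particle in the self-attention dynamics. -/
def saField {n d : ℕ} (β : ℝ) (x : Fin n → EuclideanSpace ℝ (Fin d)) (i : Fin n) :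
    EuclideanSpace ℝ (Fin d) :=
  tangentProj (x i)
    ((partitionFn β x i)⁻¹ • ∑ j, Real.exp (β * inner ℝ (x i) (x j)) • x j)

/-- `x` solves, on `[0, ∞)` and with values in `(S^{d-1})^n`, the Cauchy problem for the
self-attention dynamics with initial datum `x₀`. The time derivative is one-sided at `t = 0`;
values of `x` at negative times are irrelevant. -/
structure IsSASolution {n d : ℕ} (β : ℝ) (x₀ : Fin n → UnitSphere d)
    (x : ℝ → Fin n → EuclideanSpace ℝ (Fin d)) : Prop where
  mem_sphere : ∀ t : ℝ, 0 ≤ t → ∀ i, x t i ∈ Metric.sphere (0 : EuclideanSpace ℝ (Fin d)) 1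
  initial : ∀ i, x 0 i = x₀ i
  hasDeriv : ∀ t : ℝ, 0 ≤ t → ∀ i,
    HasDerivWithinAt (fun s => x s i) (saField β (x t) i) (Set.Ici 0) t

/-- `γ` solves on `[0, ∞)` the scalar Cauchy problem
`γ' = 2 e^{βγ} (1 - γ) ((n - 1) γ + 1) / (e^β + (n - 1) e^{βγ})`, `γ(0) = 0`. -/
structure IsGammaSolution (β : ℝ) (n : ℕ) (γ : ℝ → ℝ) : Prop where
  initial : γ 0 = 0
  hasDeriv : ∀ t : ℝ, 0 ≤ t →
    HasDerivWithinAt γ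
      (2 * Real.exp (β * γ t) * (1 - γ t) * (((n : ℝ) - 1) * γ t + 1) /
        (Real.exp β + ((n : ℝ) - 1) * Real.exp (β * γ t))) (Set.Ici 0) t

/-- The constant `c(β) = exp (10 max {1, β})`. -/
def cConst (β : ℝ) : ℝ := Real.exp (10 * max 1 β)

end

/-! Three facts combine. The Gram matrix of the particles satisfies a closed differential equation
in which `d` does not appear (`inner_saField`). On matrices with unit diagonal and a common
off-diagonal entry `y`, this equation reduces to the scalar equation for `γ`
(`gramDrift_equiangularGram`). Finally, independent uniform points on a high-dimensional sphere are
almost orthogonal (`exists_measurableSet_abs_inner_le`), so the Gram matrix starts within `√(log d /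
d)` of the equiangular matrix with `γ 0 = 0`.

The growing bound is a Grönwall estimate: the Gram drift is Lipschitz in the sup norm around the
equiangular solution (`abs_gramDrift_sub_le`), so the initial error grows at most exponentially.

For the decaying bound, `γ 1 > 0`, and for large `d` the Grönwall error at time 1 is below `γ 1`, so
all correlations are then nonnegative. From that moment the smallest correlation is pushed towards 1
at an exponential rate independent of `d` (`one_sub_inner_le_exp`). Since `γ` also converges
exponentially to 1 (`one_sub_gamma_le_exp`), so does the difference to 0. Each of these comparisons
is an instance of one first-contact principle, `forall_le_of_hasDerivWithinAt_lt_at_contact`. -/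

/-! ### First-contact comparison principle. -/

section Barrier

/-- A finite family of functions lying below a barrier at time `a` stays below it as long as
any member touching the barrier grows strictly slower than the barrier. -/
theorem forall_le_of_hasDerivWithinAt_lt_at_contact {ι : Type*} [Finite ι] {f f' : ι → ℝ → ℝ}
    {B B' : ℝ → ℝ} {a : ℝ}
    (hf : ∀ i t, a ≤ t → HasDerivWithinAt (f i) (f' i t) (Set.Ici a) t)
    (hB : ∀ t, a ≤ t → HasDerivWithinAt B (B' t) (Set.Ici a) t)
    (ha : ∀ i, f i a ≤ B a)
    (hlt : ∀ t, a ≤ t → (∀ i, f i t ≤ B t) → ∀ i, f i t = B t → f' i t < B' t)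
    {t : ℝ} (ht : a ≤ t) (i : ι) : f i t ≤ B t := by
  have hcf (i : ι) : ContinuousOn (f i) (Set.Icc a t) := fun s hs =>
    ((hf i s hs.1).continuousWithinAt).mono Set.Icc_subset_Ici_self
  have hcB : ContinuousOn B (Set.Icc a t) := fun s hs =>
    ((hB s hs.1).continuousWithinAt).mono Set.Icc_subset_Ici_self
  have hclosed : IsClosed ({s | ∀ i, f i s ≤ B s} ∩ Set.Icc a t) := by
    have : {s | ∀ i, f i s ≤ B s} ∩ Set.Icc a t
        = Set.Icc a t ∩ ⋂ i, (Set.Icc a t ∩ {s | f i s ≤ B s}) := by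
      ext s
      simp only [Set.mem_inter_iff, Set.mem_ofPred_eq, Set.mem_iInter]
      exact ⟨fun h => ⟨h.2, fun i => ⟨h.2, h.1 i⟩⟩, fun h => ⟨fun i => (h.2 i).2, h.1⟩⟩
    rw [this]
    refine isClosed_Icc.inter (isClosed_iInter fun i => ?_)
    have := (hcB.sub (hcf i)).preimage_isClosed_of_isClosed isClosed_Icc (isClosed_Ici (a := 0))
    convert this using 1
    ext s
    simp
  refine hclosed.Icc_subset_of_forall_exists_gt (a := a) ha ?_ (Set.right_mem_Icc.2 ht) i
  rintro x ⟨hx, hxa, hxt⟩ y hy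
  -- Just after `x`, a member strictly below the barrier stays there by continuity; one in contact
  -- stays there because `B - f i` vanishes with positive right derivative.
  have hev : ∀ᶠ z in nhdsWithin x (Set.Ioi x), ∀ i, f i z ≤ B z := by
    rw [Filter.eventually_all]
    intro i
    have hsub : Set.Ioi x ⊆ Set.Ici a := fun z hz => hxa.trans (le_of_lt hz)
    have hd := ((hB x hxa).sub (hf i x hxa)).mono hsub
    rcases (hx i).lt_or_eq with h | h
    · have : Filter.Tendsto (B - f i) (nhdsWithin x (Set.Ioi x)) (nhds (B x - f i x)) :=
        hd.continuousWithinAt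
      filter_upwards [this.eventually (lt_mem_nhds (sub_pos.2 h))] with z hz
      have : 0 < B z - f i z := hz
      linarith
    · have hpos := sub_pos.2 (hlt x hxa hx i h)
      have hs := (hasDerivWithinAt_iff_tendsto_slope.1 hd)
      rw [Set.sdiff_singleton_eq_self (by simp)] at hs
      filter_upwards [hs.eventually (lt_mem_nhds hpos), self_mem_nhdsWithin] with z hz hxz
      have hxz' : 0 < z - x := sub_pos.2 hxz
      rw [slope_def_field, lt_div_iff₀ hxz'] at hz
      simp only [Pi.sub_apply, zero_mul] at hz
      linarith
  obtain ⟨z, hz, hz'⟩ := (hev.and (Ioc_mem_nhdsGT hy)).exists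
  exact ⟨z, hz, hz'⟩

end Barrier

/-! ### Forward uniqueness and global existence for autonomous equations. -/

section ODE

variable {E : Type*} [NormedAddCommGroup E] [NormedSpace ℝ E]

/-- Two forward solutions of an autonomous `C¹` equation with the same initial value agree. -/
theorem eqOn_Ici_of_hasDerivWithinAt_of_contDiff [FiniteDimensional ℝ E] {F : E → E}
    (hF : ContDiff ℝ 1 F) {f g : ℝ → E}
    (hf : ∀ t, 0 ≤ t → HasDerivWithinAt f (F (f t)) (Set.Ici 0) t)
    (hg : ∀ t, 0 ≤ t → HasDerivWithinAt g (F (g t)) (Set.Ici 0) t)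
    (h0 : f 0 = g 0) : Set.EqOn f g (Set.Ici 0) := by
  intro T hT
  have hcf : ContinuousOn f (Set.Icc 0 T) := fun s hs =>
    ((hf s hs.1).continuousWithinAt).mono Set.Icc_subset_Ici_self
  have hcg : ContinuousOn g (Set.Icc 0 T) := fun s hs =>
    ((hg s hs.1).continuousWithinAt).mono Set.Icc_subset_Ici_self
  obtain ⟨R, hR⟩ := ((isCompact_Icc.image_of_continuousOn hcf).union
    (isCompact_Icc.image_of_continuousOn hcg)).isBounded.subset_closedBall (0 : E)
  have : ProperSpace E := FiniteDimensional.proper ℝ E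
  obtain ⟨K, hK⟩ := hF.contDiffOn.exists_lipschitzOnWith one_ne_zero
    (convex_closedBall (0 : E) R) (isCompact_closedBall 0 R)
  refine ODE_solution_unique_of_mem_Icc_right (v := fun _ => F) (K := K)
    (s := fun _ => Metric.closedBall 0 R) (fun _ _ => hK) hcf ?_ ?_ hcg ?_ ?_ h0
    (Set.right_mem_Icc.2 hT)
  · exact fun t ht => (hf t ht.1).mono (Set.Ici_subset_Ici.2 ht.1)
  · exact fun t ht => hR (Or.inl ⟨t, ⟨ht.1, ht.2.le⟩, rfl⟩)
  · exact fun t ht => (hg t ht.1).mono (Set.Ici_subset_Ici.2 ht.1)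
  · exact fun t ht => hR (Or.inr ⟨t, ⟨ht.1, ht.2.le⟩, rfl⟩)

/-- A bounded, globally Lipschitz autonomous vector field has forward solutions for all time. -/
theorem exists_forall_hasDerivWithinAt_Ici_of_lipschitzWith [CompleteSpace E] {F : E → E}
    {K : NNReal} (hF : LipschitzWith K F) {M : NNReal} (hM : ∀ x, ‖F x‖ ≤ M) (x₀ : E) :
    ∃ f : ℝ → E, f 0 = x₀ ∧
      ∀ t, 0 ≤ t → HasDerivWithinAt f (F (f t)) (Set.Ici 0) t := by
  have hloc (N : ℕ) : ∃ f : ℝ → E, f 0 = x₀ ∧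
      ∀ t ∈ Set.Icc (0 : ℝ) N, HasDerivWithinAt f (F (f t)) (Set.Icc 0 (N : ℝ)) t := by
    -- As the field is bounded by `M`, a solution on `[0, N]` cannot leave the ball of radius `M *
    -- N`, which makes Picard–Lindelöf apply for every `N`.
    have hp : IsPicardLindelof (fun _ => F) (⟨0, by simp⟩ : Set.Icc (0 : ℝ) N) x₀
        (M * N) 0 M K :=
      { lipschitzOnWith := fun _ _ => hF.lipschitzOnWith
        continuousOn := fun _ _ => continuousOn_const
        norm_le := fun _ _ x _ => hM x
        mul_max_le := by simp }
    exact hp.exists_eq_forall_mem_Icc_hasDerivWithinAt (x := x₀) (by simp)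
  choose f hf0 hf using hloc
  have hagree {N N' : ℕ} (h : N ≤ N') : Set.EqOn (f N) (f N') (Set.Icc 0 (N : ℝ)) := by
    have hsub : Set.Icc (0 : ℝ) N ⊆ Set.Icc 0 (N' : ℝ) :=
      Set.Icc_subset_Icc_right (by exact_mod_cast h)
    refine ODE_solution_unique_of_mem_Icc_right (v := fun _ => F) (K := K)
      (s := fun _ => Set.univ) (fun _ _ => hF.lipschitzOnWith)
      (fun t ht => (hf N t ht).continuousWithinAt) ?_ (fun _ _ => trivial)
      (fun t ht => (hf N' t (hsub ht)).continuousWithinAt.mono hsub) ?_ (fun _ _ => trivial)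
      (by rw [hf0, hf0])
    · exact fun t ht => (hf N t ⟨ht.1, ht.2.le⟩).mono_of_mem_nhdsWithin
        (Icc_mem_nhdsGE_of_mem ht)
    · exact fun t ht => ((hf N' t (hsub ⟨ht.1, ht.2.le⟩)).mono hsub).mono_of_mem_nhdsWithin
        (Icc_mem_nhdsGE_of_mem ht)
  -- The `+ 1` keeps `t` strictly below the right endpoint, so that the derivative within the
  -- interval is one within `Set.Ici 0`.
  refine ⟨fun t => f (⌈t⌉₊ + 1) t, by simpa using hf0 _, fun t ht => ?_⟩
  have heq (N : ℕ) (s : ℝ) (hs : s ∈ Set.Icc (0 : ℝ) N) : f (⌈s⌉₊ + 1) s = f N s := by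
    rcases le_total (⌈s⌉₊ + 1) N with h | h
    · refine hagree h ⟨hs.1, ?_⟩
      push_cast
      linarith [Nat.le_ceil s]
    · exact (hagree h hs).symm
  have hlt : t < ((⌈t⌉₊ + 1 : ℕ) : ℝ) := by
    push_cast
    linarith [Nat.le_ceil t]
  have hmem : Set.Icc (0 : ℝ) ((⌈t⌉₊ + 1 : ℕ) : ℝ) ∈ nhdsWithin t (Set.Ici 0) := by
    rw [← Set.Ici_inter_Iic]
    exact Filter.inter_mem self_mem_nhdsWithin (mem_nhdsWithin_of_mem_nhds (Iic_mem_nhds hlt))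
  refine ((hf (⌈t⌉₊ + 1) t ⟨ht, hlt.le⟩).mono_of_mem_nhdsWithin hmem).congr_of_eventuallyEq
    ?_ rfl
  filter_upwards [hmem] with s hs using heq _ s hs

end ODE

/-! ### Well-posedness of the particle system. -/

section Particles

variable {n d : ℕ} {β : ℝ}

theorem partitionFn_pos (β : ℝ) (x : Fin n → EuclideanSpace ℝ (Fin d)) (i : Fin n) :
    0 < partitionFn β x i :=
  Finset.sum_pos (fun _ _ => Real.exp_pos _) ⟨i, Finset.mem_univ i⟩

/-- The Euclidean mean of the particles weighted by their attention to particle `i`. -/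
noncomputable def attentionMean (β : ℝ) (x : Fin n → EuclideanSpace ℝ (Fin d)) (i : Fin n) :
    EuclideanSpace ℝ (Fin d) :=
  (partitionFn β x i)⁻¹ • ∑ j, Real.exp (β * inner ℝ (x i) (x j)) • x j

theorem saField_eq (β : ℝ) (x : Fin n → EuclideanSpace ℝ (Fin d)) (i : Fin n) :
    saField β x i = attentionMean β x i - inner ℝ (x i) (attentionMean β x i) • x i := rfl

theorem contDiff_attentionMean (β : ℝ) (i : Fin n) :
    ContDiff ℝ 1 (fun x : Fin n → EuclideanSpace ℝ (Fin d) => attentionMean β x i) := by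
  have hproj (j : Fin n) : ContDiff ℝ 1 (fun x : Fin n → EuclideanSpace ℝ (Fin d) => x j) :=
    contDiff_apply ℝ _ j
  have hexp (j : Fin n) : ContDiff ℝ 1
      (fun x : Fin n → EuclideanSpace ℝ (Fin d) => Real.exp (β * inner ℝ (x i) (x j))) :=
    (contDiff_const.mul ((hproj i).inner ℝ (hproj j))).exp
  exact (ContDiff.inv (ContDiff.sum fun j _ => hexp j) fun x => (partitionFn_pos β x i).ne').smul
    (ContDiff.sum fun j _ => (hexp j).smul (hproj j))

theorem contDiff_saField (β : ℝ) :
    ContDiff ℝ 1 (saField β : (Fin n → EuclideanSpace ℝ (Fin d)) → _) := by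
  rw [contDiff_pi]
  intro i
  have hi : ContDiff ℝ 1 (fun x : Fin n → EuclideanSpace ℝ (Fin d) => x i) := contDiff_apply ℝ _ i
  exact (contDiff_attentionMean β i).sub ((hi.inner ℝ (contDiff_attentionMean β i)).smul hi)

/-- A trajectory whose velocity is a nonnegative multiple of the self-attention field, started on
the sphere, remains on the sphere. -/
theorem norm_eq_one_of_hasDerivWithinAt_smul_saField {x : ℝ → Fin n → EuclideanSpace ℝ (Fin d)}
    {χ : (Fin n → EuclideanSpace ℝ (Fin d)) → ℝ} (hχ : Continuous χ)
    (hx : ∀ t, 0 ≤ t → HasDerivWithinAt x (χ (x t) • saField β (x t)) (Set.Ici 0) t)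
    (h0 : ∀ i, ‖x 0 i‖ = 1) {T : ℝ} (hT : 0 ≤ T) (i : Fin n) : ‖x T i‖ = 1 := by
  have hc : ContinuousOn x (Set.Icc 0 T) := fun s hs =>
    ((hx s hs.1).continuousWithinAt).mono Set.Icc_subset_Ici_self
  let a : (Fin n → EuclideanSpace ℝ (Fin d)) → ℝ :=
    fun y => 2 * χ y * inner ℝ (y i) (attentionMean β y i)
  have ha : Continuous a := (continuous_const.mul hχ).mul
    ((continuous_apply i).inner (contDiff_attentionMean β i).continuous)
  obtain ⟨K, hK⟩ := isCompact_Icc.exists_bound_of_continuousOn (ha.comp_continuousOn hc)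
  -- The field is not tangent off the unit sphere, but the defect `‖x i‖ ^ 2 - 1` solves a linear
  -- homogeneous equation and starts at 0.
  have hd (t : ℝ) (ht : 0 ≤ t) : HasDerivWithinAt (fun s => ‖x s i‖ ^ 2 - 1)
      (-(a (x t)) * (‖x t i‖ ^ 2 - 1)) (Set.Ici 0) t := by
    have h1 := ((hasDerivWithinAt_pi.1 (hx t ht) i).norm_sq).sub_const 1
    refine h1.congr_deriv ?_
    simp only [Pi.smul_apply, saField_eq, a, inner_smul_right, inner_sub_right,
      real_inner_self_eq_norm_sq]
    ring
  have hz := eq_zero_of_abs_deriv_le_mul_abs_self_of_eq_zero_right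
    (f := fun s => ‖x s i‖ ^ 2 - 1) (f' := fun t => -(a (x t)) * (‖x t i‖ ^ 2 - 1)) (K := K)
    (a := 0) (b := T)
    (fun s hs => (hd s hs.1).continuousWithinAt.mono Set.Icc_subset_Ici_self)
    (fun s hs => (hd s hs.1).mono (Set.Ici_subset_Ici.2 hs.1)) (by simp [h0])
    (fun s hs => by
      rw [norm_mul, norm_neg]
      exact mul_le_mul_of_nonneg_right (hK s ⟨hs.1, hs.2.le⟩) (norm_nonneg _))
    T (Set.right_mem_Icc.2 hT)
  have : ‖x T i‖ ^ 2 = 1 := by linarith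
  exact (pow_eq_one_iff_of_nonneg (norm_nonneg _) two_ne_zero).1 this

theorem IsSASolution.norm_eq_one {x₀ : Fin n → UnitSphere d}
    {x : ℝ → Fin n → EuclideanSpace ℝ (Fin d)} (hx : IsSASolution β x₀ x) {t : ℝ} (ht : 0 ≤ t)
    (i : Fin n) : ‖x t i‖ = 1 := by
  simpa using hx.mem_sphere t ht i

/-- Global existence for the self-attention dynamics on the sphere. -/
theorem exists_isSASolution (β : ℝ) (x₀ : Fin n → UnitSphere d) :
    ∃ x, IsSASolution β x₀ x := by
  -- The cut-off makes the field bounded and globally Lipschitz. It only rescales the velocity, so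
  -- the sphere is still preserved, and there it equals 1.
  let χ : ContDiffBump (0 : Fin n → EuclideanSpace ℝ (Fin d)) := ⟨2, 3, by norm_num, by norm_num⟩
  have hsupp : HasCompactSupport fun y => χ y • saField β y := χ.hasCompactSupport.smul_right
  have hsmooth : ContDiff ℝ 1 fun y => χ y • saField β y := χ.contDiff.smul (contDiff_saField β)
  obtain ⟨K, hK⟩ := hsmooth.lipschitzWith_of_hasCompactSupport hsupp one_ne_zero
  obtain ⟨M, hM⟩ := hsupp.exists_bound_of_continuous hsmooth.continuous
  obtain ⟨x, hx0, hx⟩ := exists_forall_hasDerivWithinAt_Ici_of_lipschitzWith hK (M := M.toNNReal)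
    (fun y => (hM y).trans (Real.le_coe_toNNReal M)) (fun i => (x₀ i : EuclideanSpace ℝ (Fin d)))
  have hnorm (t : ℝ) (ht : 0 ≤ t) (i : Fin n) : ‖x t i‖ = 1 :=
    norm_eq_one_of_hasDerivWithinAt_smul_saField χ.continuous hx (fun i => by simp [hx0]) ht i
  refine ⟨x, fun t ht i => by simpa using hnorm t ht i, fun i => by rw [hx0], fun t ht i => ?_⟩
  have h1 : χ (x t) = 1 := by
    refine χ.one_of_mem_closedBall ?_
    rw [mem_closedBall_zero_iff, pi_norm_le_iff_of_nonneg (by norm_num)]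
    intro i
    rw [hnorm t ht i]
    norm_num
  have := hasDerivWithinAt_pi.1 (hx t ht) i
  rwa [h1, one_smul] at this

/-- Uniqueness for the self-attention dynamics. -/
theorem IsSASolution.eqOn {x₀ : Fin n → UnitSphere d}
    {x y : ℝ → Fin n → EuclideanSpace ℝ (Fin d)} (hx : IsSASolution β x₀ x)
    (hy : IsSASolution β x₀ y) : Set.EqOn y x (Set.Ici 0) :=
  eqOn_Ici_of_hasDerivWithinAt_of_contDiff (contDiff_saField β)
    (fun t ht => hasDerivWithinAt_pi.2 (hy.hasDeriv t ht))
    (fun t ht => hasDerivWithinAt_pi.2 (hx.hasDeriv t ht))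
    (funext fun i => (hy.initial i).trans (hx.initial i).symm)

end Particles

/-! ### The scalar equation for the common correlation. -/

section MeanField

/-- The right-hand side of the scalar equation. -/
noncomputable def gammaField (β : ℝ) (n : ℕ) (y : ℝ) : ℝ :=
  2 * Real.exp (β * y) * (1 - y) * (((n : ℝ) - 1) * y + 1) /
    (Real.exp β + ((n : ℝ) - 1) * Real.exp (β * y))

variable {β : ℝ} {n : ℕ}

theorem gammaField_denom_pos (hn : 1 ≤ n) (β y : ℝ) :
    0 < Real.exp β + ((n : ℝ) - 1) * Real.exp (β * y) := by
  have : (1 : ℝ) ≤ n := by exact_mod_cast hn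
  exact add_pos_of_pos_of_nonneg (Real.exp_pos _)
    (mul_nonneg (by linarith) (Real.exp_pos _).le)

theorem contDiff_gammaField (hn : 1 ≤ n) (β : ℝ) : ContDiff ℝ 1 (gammaField β n) := by
  unfold gammaField
  refine ContDiff.div (by fun_prop) (by fun_prop) fun y => (gammaField_denom_pos hn β y).ne'

theorem gammaField_nonneg (hn : 1 ≤ n) {y : ℝ} (h0 : 0 ≤ y) (h1 : y ≤ 1) :
    0 ≤ gammaField β n y := by
  have : (1 : ℝ) ≤ n := by exact_mod_cast hn
  refine div_nonneg (mul_nonneg (mul_nonneg (by positivity) (by linarith)) ?_)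
    (gammaField_denom_pos hn β y).le
  nlinarith

/-- On `[0, 1]` the numerator is at least `2 * (1 - y)` and the denominator at most `n * exp β`.
This gives the convergence rate of `γ` to 1. -/
theorem le_gammaField (hβ : 0 ≤ β) (hn : 1 ≤ n) {y : ℝ} (h0 : 0 ≤ y) (h1 : y ≤ 1) :
    2 * Real.exp (-β) / n * (1 - y) ≤ gammaField β n y := by
  have hn' : (1 : ℝ) ≤ n := by exact_mod_cast hn
  have hβy : 1 ≤ Real.exp (β * y) := Real.one_le_exp (by positivity)
  have hβy' : Real.exp (β * y) ≤ Real.exp β := Real.exp_le_exp.2 (by nlinarith)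
  rw [gammaField, le_div_iff₀ (gammaField_denom_pos hn β y)]
  calc 2 * Real.exp (-β) / n * (1 - y) * (Real.exp β + ((n : ℝ) - 1) * Real.exp (β * y))
      ≤ 2 * Real.exp (-β) / n * (1 - y) * (Real.exp β + ((n : ℝ) - 1) * Real.exp β) := by
        have : 0 ≤ 2 * Real.exp (-β) / n * (1 - y) := mul_nonneg (by positivity) (by linarith)
        gcongr
    _ = 2 * 1 * (1 - y) * 1 := by
        rw [Real.exp_neg]
        field_simp
        ring
    _ ≤ 2 * Real.exp (β * y) * (1 - y) * (((n : ℝ) - 1) * y + 1) := by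
        have h2 : 0 ≤ 1 - y := by linarith
        have h3 : 0 ≤ ((n : ℝ) - 1) * y := mul_nonneg (by linarith) h0
        gcongr
        linarith

/-- Composing the field with the projection onto `[0, 1]` makes it bounded and Lipschitz. The
modified solution never leaves `[0, 1]`, because the field is nonnegative there and vanishes at 1,
so it solves the original equation. -/
theorem exists_isGammaSolution (hn : 1 ≤ n) (β : ℝ) :
    ∃ γ, IsGammaSolution β n γ ∧ ∀ t, 0 ≤ t → 0 ≤ γ t ∧ γ t ≤ 1 := by
  obtain ⟨K, hK⟩ := (contDiff_gammaField hn β).contDiffOn.exists_lipschitzOnWith one_ne_zero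
    (convex_Icc 0 1) isCompact_Icc
  obtain ⟨M, hM⟩ := isCompact_Icc.exists_bound_of_continuousOn
    (contDiff_gammaField hn β).continuous.continuousOn (s := Set.Icc (0 : ℝ) 1)
  let P : ℝ → ℝ := fun y => Set.projIcc 0 1 zero_le_one y
  have hP (y : ℝ) : P y ∈ Set.Icc (0 : ℝ) 1 := Subtype.coe_prop _
  have hlip : LipschitzWith K (gammaField β n ∘ P) := by
    have : LipschitzWith 1 P := by
      have := (LipschitzWith.subtype_val (Set.Icc (0 : ℝ) 1)).comp
        (LipschitzWith.projIcc (zero_le_one (α := ℝ)))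
      rwa [one_mul] at this
    have := hK.comp (this.lipschitzOnWith (s := Set.univ)) (fun y _ => hP y)
    rwa [mul_one, lipschitzOnWith_univ] at this
  obtain ⟨γ, h0, hγ⟩ := exists_forall_hasDerivWithinAt_Ici_of_lipschitzWith hlip
    (M := M.toNNReal) (fun y => (hM _ (hP y)).trans (Real.le_coe_toNNReal M)) 0
  have hmono : MonotoneOn γ (Set.Ici 0) := by
    refine monotoneOn_of_hasDerivWithinAt_nonneg (convex_Ici 0)
      (fun t ht => (hγ t ht).continuousWithinAt)
      (fun t ht => (hγ t (interior_subset ht)).mono interior_subset)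
      (fun t _ => gammaField_nonneg hn (hP _).1 (hP _).2)
  have hle (t : ℝ) (ht : 0 ≤ t) : γ t ≤ 1 := by
    refine le_of_forall_pos_le_add fun ε hε => ?_
    have := forall_le_of_hasDerivWithinAt_lt_at_contact (ι := Unit) (a := 0)
      (f := fun _ => γ) (f' := fun _ s => gammaField β n (P (γ s)))
      -- A strictly increasing barrier above 1, with slope normalised to reach `1 + ε` at time `t`.
      (B := fun s => 1 + ε / (1 + t) * (1 + s)) (B' := fun _ => ε / (1 + t))
      (fun _ s hs => hγ s hs)
      (fun s _ => by
        simpa using (((hasDerivWithinAt_id s (Set.Ici 0)).const_add 1).const_mul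
          (ε / (1 + t))).const_add 1)
      (fun _ => by rw [h0]; positivity)
      (fun s hs _ _ heq => by
        have h1 : 1 ≤ γ s := by
          rw [heq]
          have : 0 ≤ ε / (1 + t) * (1 + s) := by positivity
          linarith
        have : P (γ s) = 1 := by simp [P, Set.projIcc_of_right_le _ h1]
        rw [this]
        simp only [gammaField, sub_self, mul_zero, zero_mul, zero_div]
        positivity) ht ()
    rwa [div_mul_cancel₀ _ (by positivity)] at this
  have hge (t : ℝ) (ht : 0 ≤ t) : 0 ≤ γ t := h0 ▸ hmono Set.self_mem_Ici ht ht
  refine ⟨γ, ⟨h0, fun t ht => ?_⟩, fun t ht => ⟨hge t ht, hle t ht⟩⟩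
  have := hγ t ht
  simp only [Function.comp_apply, P, Set.projIcc_of_mem _ ⟨hge t ht, hle t ht⟩] at this
  exact this

theorem IsGammaSolution.eqOn (hn : 1 ≤ n) {γ γ' : ℝ → ℝ} (h : IsGammaSolution β n γ)
    (h' : IsGammaSolution β n γ') : Set.EqOn γ' γ (Set.Ici 0) :=
  eqOn_Ici_of_hasDerivWithinAt_of_contDiff (contDiff_gammaField hn β) h'.hasDeriv h.hasDeriv
    (h'.initial.trans h.initial.symm)

end MeanField

/-! ### Near-orthogonality of random points on the sphere. -/

section Sphere

variable {d : ℕ}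

theorem isProbabilityMeasure_uniformSphere (hd : 1 ≤ d) :
    IsProbabilityMeasure (uniformSphere d) := by
  have : Nonempty (Fin d) := ⟨⟨0, hd⟩⟩
  refine ⟨?_⟩
  rw [uniformSphere, Measure.smul_apply, smul_eq_mul]
  refine ENNReal.inv_mul_cancel ?_ (measure_ne_top _ _)
  rw [Measure.measure_univ_ne_zero]
  exact Measure.toSphere_ne_zero _

open scoped Pointwise in
/-- A spherical cap `{v | ε ≤ ⟨u, v⟩}` has uniform measure at most `(1 - ε²)^{d/2}`, because the
cone over it lies in the ball of centre `ε u` and radius `√(1 - ε²)`. -/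
theorem uniformSphere_cap_le (hd : 1 ≤ d) {u : EuclideanSpace ℝ (Fin d)} (hu : ‖u‖ = 1) {ε : ℝ}
    (hε : 0 ≤ ε) (hε' : ε ^ 2 ≤ 1 / 2) :
    uniformSphere d {v | ε ≤ inner ℝ u (v : EuclideanSpace ℝ (Fin d))}
      ≤ ENNReal.ofReal (√(1 - ε ^ 2) ^ d) := by
  have : Nonempty (Fin d) := ⟨⟨0, hd⟩⟩
  have hmeas : MeasurableSet
      {v : UnitSphere d | ε ≤ inner ℝ u (v : EuclideanSpace ℝ (Fin d))} :=
    (isClosed_le continuous_const (continuous_const.inner continuous_subtype_val)).measurableSet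
  have hsub : Set.Ioo (0 : ℝ) 1 •
      (((↑) : UnitSphere d → EuclideanSpace ℝ (Fin d)) '' {v | ε ≤ inner ℝ u v.1})
      ⊆ Metric.ball (ε • u) √(1 - ε ^ 2) := by
    rintro _ ⟨r, ⟨hr0, hr1⟩, _, ⟨v, hv, rfl⟩, rfl⟩
    have hv1 : ‖(v : EuclideanSpace ℝ (Fin d))‖ = 1 := by simp
    have hv' : ε ≤ inner ℝ u (v : EuclideanSpace ℝ (Fin d)) := hv
    simp only [Metric.mem_ball, dist_eq_norm]
    refine Real.lt_sqrt_of_sq_lt ?_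
    rw [norm_sub_sq_real, norm_smul, norm_smul, hu, hv1, inner_smul_left, inner_smul_right,
      real_inner_comm]
    simp only [Real.norm_eq_abs, mul_one, sq_abs, conj_trivial]
    have h1 : r * (ε * ε) ≤ r * (ε * inner ℝ u (v : EuclideanSpace ℝ (Fin d))) := by gcongr
    -- What remains is `(1 - r) * (1 + r - 2 * ε ^ 2) > 0`, true since `0 < r < 1` and `2 * ε ^ 2 ≤
    -- 1`.
    nlinarith [mul_pos (sub_pos.2 hr1) hr0, mul_nonneg (sub_pos.2 hr1).le (sub_nonneg.2 hε')]
  have hball : (volume : Measure (EuclideanSpace ℝ (Fin d))) (Metric.ball 0 1) ≠ 0 :=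
    (Metric.measure_ball_pos _ _ one_pos).ne'
  have hdim : ((d : ℕ) : ENNReal) ≠ 0 := by
    simp only [ne_eq, Nat.cast_eq_zero]
    omega
  rw [uniformSphere, Measure.smul_apply, smul_eq_mul, Measure.toSphere_apply' _ hmeas,
    Measure.toSphere_apply_univ, finrank_euclideanSpace_fin]
  calc (d * volume (Metric.ball (0 : EuclideanSpace ℝ (Fin d)) 1))⁻¹ * (d * volume _)
      ≤ (d * volume (Metric.ball (0 : EuclideanSpace ℝ (Fin d)) 1))⁻¹ *
        (d * volume (Metric.ball (ε • u) √(1 - ε ^ 2))) := by gcongr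
    _ = (d * volume (Metric.ball (0 : EuclideanSpace ℝ (Fin d)) 1))⁻¹ *
        (d * volume (Metric.ball (0 : EuclideanSpace ℝ (Fin d)) 1)) *
          ENNReal.ofReal (√(1 - ε ^ 2) ^ d) := by
        rw [Measure.addHaar_ball _ _ (Real.sqrt_nonneg _), finrank_euclideanSpace_fin]
        ring
    _ = ENNReal.ofReal (√(1 - ε ^ 2) ^ d) := by
        rw [ENNReal.inv_mul_cancel (mul_ne_zero hdim hball)
          (ENNReal.mul_ne_top (ENNReal.natCast_ne_top d) measure_ball_lt_top.ne), one_mul]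

theorem sqrt_one_sub_sq_pow_le (d : ℕ) (ε : ℝ) :
    √(1 - ε ^ 2) ^ d ≤ Real.exp (-(d * ε ^ 2 / 2)) := by
  have : √(1 - ε ^ 2) ≤ Real.exp (-(ε ^ 2 / 2)) := by
    refine Real.sqrt_le_iff.2 ⟨(Real.exp_pos _).le, ?_⟩
    rw [← Real.exp_nat_mul]
    refine (Real.one_sub_le_exp_neg (ε ^ 2)).trans (le_of_eq ?_)
    congr 1
    push_cast
    ring
  refine (pow_le_pow_left₀ (Real.sqrt_nonneg _) this d).trans (le_of_eq ?_)
  rw [← Real.exp_nat_mul]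
  congr 1
  ring

/-- Two-sided sub-Gaussian tail bound for a coordinate of a uniform point on the sphere. -/
theorem uniformSphere_abs_inner_ge_le (hd : 1 ≤ d) {u : EuclideanSpace ℝ (Fin d)} (hu : ‖u‖ = 1)
    {ε : ℝ} (hε : 0 ≤ ε) (hε' : ε ^ 2 ≤ 1 / 2) :
    uniformSphere d {v | ε ≤ |inner ℝ u (v : EuclideanSpace ℝ (Fin d))|}
      ≤ ENNReal.ofReal (2 * Real.exp (-(d * ε ^ 2 / 2))) := by
  have hcap (w : EuclideanSpace ℝ (Fin d)) (hw : ‖w‖ = 1) :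
      uniformSphere d {v | ε ≤ inner ℝ w (v : EuclideanSpace ℝ (Fin d))}
        ≤ ENNReal.ofReal (Real.exp (-(d * ε ^ 2 / 2))) :=
    (uniformSphere_cap_le hd hw hε hε').trans
      (ENNReal.ofReal_le_ofReal (sqrt_one_sub_sq_pow_le d ε))
  have hsub : {v : UnitSphere d | ε ≤ |inner ℝ u (v : EuclideanSpace ℝ (Fin d))|} ⊆
      {v | ε ≤ inner ℝ u (v : EuclideanSpace ℝ (Fin d))} ∪
        {v | ε ≤ inner ℝ (-u) (v : EuclideanSpace ℝ (Fin d))} := fun v hv => by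
    simpa [inner_neg_left] using le_abs.1 hv
  refine (measure_mono hsub).trans ((measure_union_le _ _).trans ?_)
  rw [two_mul, ENNReal.ofReal_add (Real.exp_pos _).le (Real.exp_pos _).le]
  exact add_le_add (hcap u hu) (hcap (-u) (by rwa [norm_neg]))

variable {Ω : Type*} [MeasurableSpace Ω] {P : Measure Ω} [IsProbabilityMeasure P]

/-- Tail bound for the inner product of two independent uniform points on the sphere. -/
theorem measure_abs_inner_ge_le_of_indepFun (hd : 1 ≤ d) {U V : Ω → UnitSphere d}
    (hU : Measurable U) (hV : Measurable V) (hUV : IndepFun U V P)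
    (hV' : P.map V = uniformSphere d) {ε : ℝ} (hε : 0 ≤ ε) (hε' : ε ^ 2 ≤ 1 / 2) :
    P {ω | ε ≤ |inner ℝ (U ω : EuclideanSpace ℝ (Fin d)) (V ω)|}
      ≤ ENNReal.ofReal (2 * Real.exp (-(d * ε ^ 2 / 2))) := by
  have := isProbabilityMeasure_uniformSphere hd
  have := Measure.isProbabilityMeasure_map (μ := P) hU.aemeasurable
  let S : Set (UnitSphere d × UnitSphere d) :=
    {p | ε ≤ |inner ℝ (p.1 : EuclideanSpace ℝ (Fin d)) p.2|}
  have hS : MeasurableSet S := measurableSet_le measurable_const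
    ((measurable_subtype_coe.comp measurable_fst).inner
      (measurable_subtype_coe.comp measurable_snd)).abs
  have hmap := (indepFun_iff_map_prod_eq_prod_map_map hU.aemeasurable hV.aemeasurable).1 hUV
  have h1 : P {ω | ε ≤ |inner ℝ (U ω : EuclideanSpace ℝ (Fin d)) (V ω)|}
      = P.map (fun ω => (U ω, V ω)) S := (Measure.map_apply (hU.prodMk hV) hS).symm
  rw [h1, hmap, hV', Measure.prod_apply hS]
  have hu (u : UnitSphere d) : uniformSphere d (Prod.mk u ⁻¹' S)
      ≤ ENNReal.ofReal (2 * Real.exp (-(d * ε ^ 2 / 2))) :=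
    uniformSphere_abs_inner_ge_le hd (norm_eq_of_mem_sphere u) hε hε'
  refine (lintegral_mono hu).trans (le_of_eq ?_)
  rw [lintegral_const, measure_univ, mul_one]

/-- Independent uniform points on a high-dimensional sphere are nearly orthogonal with high
probability. -/
theorem exists_measurableSet_abs_inner_le {n : ℕ} (hd : 2 ≤ d) {X : Fin n → Ω → UnitSphere d}
    (hX : ∀ i, Measurable (X i)) (hind : iIndepFun X P)
    (hunif : ∀ i, P.map (X i) = uniformSphere d) :
    ∃ A : Set Ω, MeasurableSet A ∧
      1 - 2 * (n : ℝ) ^ 2 * (d : ℝ) ^ (-(1 / 2) : ℝ) ≤ P.real A ∧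
      ∀ ω ∈ A, ∀ i j, i ≠ j →
        |inner ℝ (X i ω : EuclideanSpace ℝ (Fin d)) (X j ω)| ≤ √(Real.log d / d) := by
  have hd0 : (0 : ℝ) < d := by positivity
  have hlog : 0 ≤ Real.log d / d :=
    div_nonneg (Real.log_nonneg (by exact_mod_cast (by omega : 1 ≤ d))) hd0.le
  set ε := √(Real.log d / d) with hε
  have hsq : ε ^ 2 = Real.log d / d := Real.sq_sqrt hlog
  have hhalf : ε ^ 2 ≤ 1 / 2 := by
    rw [hsq, div_le_iff₀ hd0]
    have h3 := Real.log_le_sub_one_of_pos (x := d / 2) (by positivity)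
    rw [Real.log_div hd0.ne' two_ne_zero] at h3
    linarith [Real.log_two_lt_d9]
  have hexp : Real.exp (-(d * ε ^ 2 / 2)) = (d : ℝ) ^ (-(1 / 2) : ℝ) := by
    rw [Real.rpow_def_of_pos hd0, hsq]
    congr 1
    field_simp
  let bad (p : Fin n × Fin n) : Set Ω :=
    {_ω | p.1 ≠ p.2} ∩ {ω | ε < |inner ℝ (X p.1 ω : EuclideanSpace ℝ (Fin d)) (X p.2 ω)|}
  have hmeas (p : Fin n × Fin n) : MeasurableSet (bad p) := by
    refine (MeasurableSet.const _).inter (measurableSet_lt measurable_const ?_)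
    exact ((measurable_subtype_coe.comp (hX p.1)).inner
      (measurable_subtype_coe.comp (hX p.2))).abs
  have hbad (p : Fin n × Fin n) : P.real (bad p) ≤ 2 * (d : ℝ) ^ (-(1 / 2) : ℝ) := by
    by_cases h : p.1 = p.2
    · have : bad p = ∅ := by
        ext ω
        simp [bad, h]
      rw [this, measureReal_empty]
      positivity
    · refine ENNReal.toReal_le_of_le_ofReal (by positivity) ?_
      rw [← hexp]
      refine (measure_mono fun ω hω => ?_).trans (measure_abs_inner_ge_le_of_indepFun
        (by omega) (hX p.1) (hX p.2) (hind.indepFun h) (hunif p.2) (Real.sqrt_nonneg _) hhalf)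
      have hω' : ε < |inner ℝ (X p.1 ω : EuclideanSpace ℝ (Fin d)) (X p.2 ω)| := hω.2
      exact hω'.le
  have hU : MeasurableSet (⋃ p, bad p) := MeasurableSet.iUnion hmeas
  refine ⟨(⋃ p, bad p)ᶜ, hU.compl, ?_, fun ω hω i j hij => ?_⟩
  · rw [measureReal_compl hU, probReal_univ]
    have := (measureReal_iUnion_fintype_le (μ := P) bad).trans
      (Finset.sum_le_sum fun p _ => hbad p)
    simp only [Finset.sum_const, Finset.card_univ, Fintype.card_prod, Fintype.card_fin,
      nsmul_eq_mul, Nat.cast_mul] at this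
    linarith
  · by_contra hlt
    exact hω (Set.mem_iUnion.2 ⟨(i, j), hij, not_le.1 hlt⟩)

end Sphere

/-! ### The closed dynamics of the Gram matrix. -/

section Gram

variable {n d : ℕ} {β : ℝ}

/-- The contribution of the motion of particle `i` to the derivative of the `(i, j)` entry of the
Gram matrix `G` of the particles. -/
noncomputable def gramDrift (β : ℝ) (G : Fin n → Fin n → ℝ) (i j : Fin n) : ℝ :=
  (∑ k, Real.exp (β * G i k))⁻¹ * ∑ k, Real.exp (β * G i k) * (G k j - G i k * G i j)

theorem inner_saField (β : ℝ) (x : Fin n → EuclideanSpace ℝ (Fin d)) (i j : Fin n) :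
    inner ℝ (saField β x i) (x j) = gramDrift β (fun a b => inner ℝ (x a) (x b)) i j := by
  simp only [saField_eq, attentionMean, gramDrift, partitionFn, inner_sub_left, inner_smul_left,
    inner_smul_right, sum_inner, inner_sum, conj_trivial, mul_sub, Finset.sum_sub_distrib,
    mul_assoc, Finset.sum_mul]

theorem IsSASolution.hasDerivWithinAt_inner {x₀ : Fin n → UnitSphere d}
    {x : ℝ → Fin n → EuclideanSpace ℝ (Fin d)} (hx : IsSASolution β x₀ x) {t : ℝ} (ht : 0 ≤ t)
    (i j : Fin n) :
    HasDerivWithinAt (fun s => inner ℝ (x s i) (x s j))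
      (gramDrift β (fun a b => inner ℝ (x t a) (x t b)) i j +
        gramDrift β (fun a b => inner ℝ (x t a) (x t b)) j i) (Set.Ici 0) t := by
  refine ((hx.hasDeriv t ht i).inner ℝ (hx.hasDeriv t ht j)).congr_deriv ?_
  rw [← inner_saField, ← inner_saField, real_inner_comm (x t i), add_comm]

/-- The Gram matrix with unit diagonal and all other entries equal to `y`. -/
def equiangularGram (y : ℝ) (i j : Fin n) : ℝ := if i = j then 1 else y

/-- In the numerator the term `k = i` vanishes, `k = j` gives `exp (β * y) * (1 - y ^ 2)`, and each
of the other `n - 2` gives `exp (β * y) * y * (1 - y)`. Both particles move, hence half of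
`gammaField` each. -/
theorem gramDrift_equiangularGram (β y : ℝ) {i j : Fin n} (hij : i ≠ j) :
    gramDrift β (equiangularGram y) i j = gammaField β n y / 2 := by
  have hZ : ∑ k, Real.exp (β * equiangularGram y i k)
      = Real.exp β + ((n : ℝ) - 1) * Real.exp (β * y) := by
    have (k : Fin n) : Real.exp (β * equiangularGram y i k)
        = Real.exp (β * y) + if i = k then Real.exp β - Real.exp (β * y) else 0 := by
      unfold equiangularGram
      split_ifs <;> simp
    simp only [this, Finset.sum_add_distrib, Finset.sum_const, Finset.card_univ, Fintype.card_fin,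
      nsmul_eq_mul, Finset.sum_ite_eq, Finset.mem_univ, if_true]
    ring
  have hN : ∑ k, Real.exp (β * equiangularGram y i k) *
      (equiangularGram y k j - equiangularGram y i k * equiangularGram y i j)
      = Real.exp (β * y) * (1 - y) * (((n : ℝ) - 1) * y + 1) := by
    have (k : Fin n) : Real.exp (β * equiangularGram y i k) *
        (equiangularGram y k j - equiangularGram y i k * equiangularGram y i j)
        = Real.exp (β * y) * (y - y * y) +
          (if i = k then -(Real.exp (β * y) * (y - y * y)) else 0) +
          (if k = j then Real.exp (β * y) * (1 - y) else 0) := by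
      unfold equiangularGram
      rw [if_neg hij]
      by_cases h : i = k
      · have : k ≠ j := h ▸ hij
        simp [h, this]
      · by_cases h' : k = j
        · subst h'
          simp only [hij, if_true, if_false]
          ring
        · simp [h, h']
    simp only [this, Finset.sum_add_distrib, Finset.sum_const, Finset.card_univ, Fintype.card_fin,
      nsmul_eq_mul, Finset.sum_ite_eq, Finset.sum_ite_eq', Finset.mem_univ, if_true]
    ring
  rw [gramDrift, hZ, hN, gammaField]
  ring

theorem sum_exp_pos (a : Fin n → ℝ) (i : Fin n) : 0 < ∑ k, Real.exp (a k) :=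
  Finset.sum_pos (fun _ _ => Real.exp_pos _) ⟨i, Finset.mem_univ i⟩

/-- The softmax weights vary in a relatively Lipschitz way. -/
theorem softmax_sub_le {a b : Fin n → ℝ} {c : ℝ} (hab : ∀ k, |a k - b k| ≤ c) (k : Fin n) :
    (∑ l, Real.exp (a l))⁻¹ * Real.exp (a k) - (∑ l, Real.exp (b l))⁻¹ * Real.exp (b k)
      ≤ 2 * c * ((∑ l, Real.exp (a l))⁻¹ * Real.exp (a k)) := by
  have hA := sum_exp_pos a k
  have hB := sum_exp_pos b k
  have h1 : Real.exp (a k) * Real.exp (-c) ≤ Real.exp (b k) := by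
    rw [← Real.exp_add]
    exact Real.exp_le_exp.2 (by linarith [(abs_le.1 (hab k)).2])
  have h2 : ∑ l, Real.exp (b l) ≤ (∑ l, Real.exp (a l)) * Real.exp c := by
    rw [Finset.sum_mul]
    refine Finset.sum_le_sum fun l _ => ?_
    rw [← Real.exp_add]
    exact Real.exp_le_exp.2 (by linarith [(abs_le.1 (hab l)).1])
  have h3 : (∑ l, Real.exp (a l))⁻¹ * Real.exp (-c) ≤ (∑ l, Real.exp (b l))⁻¹ := by
    rw [Real.exp_neg, ← mul_inv]
    exact inv_anti₀ hB h2
  -- Numerator and partition function each change by a factor of at most `exp c`.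
  have h4 : (∑ l, Real.exp (a l))⁻¹ * Real.exp (a k) * Real.exp (-(2 * c))
      ≤ (∑ l, Real.exp (b l))⁻¹ * Real.exp (b k) := by
    calc (∑ l, Real.exp (a l))⁻¹ * Real.exp (a k) * Real.exp (-(2 * c))
        = ((∑ l, Real.exp (a l))⁻¹ * Real.exp (-c)) * (Real.exp (a k) * Real.exp (-c)) := by
          rw [show -(2 * c) = -c + -c by ring, Real.exp_add]
          ring
      _ ≤ _ := by gcongr
  have h5 := Real.one_sub_le_exp_neg (2 * c)
  have h6 : 0 ≤ (∑ l, Real.exp (a l))⁻¹ * Real.exp (a k) := by positivity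
  nlinarith [mul_le_mul_of_nonneg_left h5 h6]

/-- Lipschitz estimate for the Gram drift in the sup norm. -/
theorem abs_gramDrift_sub_le (hβ : 0 ≤ β) {G H : Fin n → Fin n → ℝ} {B : ℝ}
    (hG : ∀ i j, |G i j| ≤ 1) (hH : ∀ i j, |H i j| ≤ 1) (hGH : ∀ i j, |G i j - H i j| ≤ B)
    {i j : Fin n} (hv : ∀ k, 0 ≤ H k j - H i k * H i j ∧ H k j - H i k * H i j ≤ 1) :
    |gramDrift β G i j - gramDrift β H i j| ≤ (3 + 2 * β) * B := by
  set p : Fin n → ℝ := fun k => (∑ l, Real.exp (β * G i l))⁻¹ * Real.exp (β * G i k) with hp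
  set q : Fin n → ℝ := fun k => (∑ l, Real.exp (β * H i l))⁻¹ * Real.exp (β * H i k) with hq
  set v : Fin n → ℝ := fun k => H k j - H i k * H i j with hvdef
  have hp1 : ∑ k, p k = 1 := by
    rw [← Finset.mul_sum]
    exact inv_mul_cancel₀ (sum_exp_pos _ i).ne'
  have hq1 : ∑ k, q k = 1 := by
    rw [← Finset.mul_sum]
    exact inv_mul_cancel₀ (sum_exp_pos _ i).ne'
  have hp0 (k) : 0 ≤ p k := mul_nonneg (inv_nonneg.2 (sum_exp_pos _ i).le) (Real.exp_pos _).le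
  have hq0 (k) : 0 ≤ q k := mul_nonneg (inv_nonneg.2 (sum_exp_pos _ i).le) (Real.exp_pos _).le
  have hexp (k) : |β * G i k - β * H i k| ≤ β * B := by
    rw [← mul_sub, abs_mul, abs_of_nonneg hβ]
    exact mul_le_mul_of_nonneg_left (hGH i k) hβ
  have hexp' (k) : |β * H i k - β * G i k| ≤ β * B := by
    rw [abs_sub_comm]
    exact hexp k
  have hB : 0 ≤ B := (abs_nonneg _).trans (hGH i i)
  have hβB : 0 ≤ 2 * (β * B) := by positivity
  -- Since `v` takes values in `[0, 1]`, the one-sided relative bound suffices; the lower bound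
  -- exchanges `p` and `q`.
  have hpq : ∑ k, (p k - q k) * v k ≤ 2 * (β * B) := by
    calc ∑ k, (p k - q k) * v k ≤ ∑ k, 2 * (β * B) * p k := by
          refine Finset.sum_le_sum fun k _ => ?_
          have h1 : p k - q k ≤ 2 * (β * B) * p k := softmax_sub_le hexp k
          have h2 := mul_le_mul_of_nonneg_right h1 (hv k).1
          exact h2.trans (mul_le_of_le_one_right (mul_nonneg hβB (hp0 k)) (hv k).2)
      _ = 2 * (β * B) := by rw [← Finset.mul_sum, hp1, mul_one]
  have hqp : ∑ k, (q k - p k) * v k ≤ 2 * (β * B) := by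
    calc ∑ k, (q k - p k) * v k ≤ ∑ k, 2 * (β * B) * q k := by
          refine Finset.sum_le_sum fun k _ => ?_
          have h1 : q k - p k ≤ 2 * (β * B) * q k := softmax_sub_le hexp' k
          have h2 := mul_le_mul_of_nonneg_right h1 (hv k).1
          exact h2.trans (mul_le_of_le_one_right (mul_nonneg hβB (hq0 k)) (hv k).2)
      _ = 2 * (β * B) := by rw [← Finset.mul_sum, hq1, mul_one]
  have hw (k) : |G k j - G i k * G i j - v k| ≤ 3 * B := by
    have e : G k j - G i k * G i j - v k
        = (G k j - H k j) - G i k * (G i j - H i j) - (G i k - H i k) * H i j := by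
      simp only [hvdef]
      ring
    have h1 : |G i k * (G i j - H i j)| ≤ 1 * B := by
      rw [abs_mul]
      exact mul_le_mul (hG i k) (hGH i j) (abs_nonneg _) zero_le_one
    have h2 : |(G i k - H i k) * H i j| ≤ B * 1 := by
      rw [abs_mul]
      exact mul_le_mul (hGH i k) (hH i j) (abs_nonneg _) hB
    have h3 := hGH k j
    rw [abs_le] at h1 h2 h3
    rw [e, abs_le]
    constructor <;> linarith
  have hpw : |∑ k, p k * (G k j - G i k * G i j - v k)| ≤ 3 * B := by
    calc |∑ k, p k * (G k j - G i k * G i j - v k)|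
        ≤ ∑ k, p k * (3 * B) := by
          refine (Finset.abs_sum_le_sum_abs _ _).trans (Finset.sum_le_sum fun k _ => ?_)
          rw [abs_mul, abs_of_nonneg (hp0 k)]
          exact mul_le_mul_of_nonneg_left (hw k) (hp0 k)
      _ = 3 * B := by rw [← Finset.sum_mul, hp1, one_mul]
  have hdecomp : gramDrift β G i j - gramDrift β H i j
      = ∑ k, p k * (G k j - G i k * G i j - v k) + ∑ k, (p k - q k) * v k := by
    rw [gramDrift, gramDrift, Finset.mul_sum, Finset.mul_sum, ← Finset.sum_sub_distrib,
      ← Finset.sum_add_distrib]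
    refine Finset.sum_congr rfl fun k _ => ?_
    simp only [hp, hq, hvdef]
    ring
  have hneg : ∑ k, (q k - p k) * v k = -∑ k, (p k - q k) * v k := by
    rw [← Finset.sum_neg_distrib]
    exact Finset.sum_congr rfl fun k _ => by ring
  rw [abs_le] at hpw
  rw [hdecomp, abs_le]
  constructor <;> linarith

/-- At a nonnegative minimal entry of a Gram matrix with entries at most `1`, the drift is
bounded below. -/
theorem le_gramDrift_of_isMin (hβ : 0 ≤ β) {G : Fin n → Fin n → ℝ} (hG : ∀ i j, G i j ≤ 1)
    (hdiag : ∀ i, G i i = 1) {i j : Fin n} (h0 : 0 ≤ G i j) (hmin : ∀ k, G i j ≤ G k j) :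
    Real.exp (-β) / n * (1 - G i j) ≤ gramDrift β G i j := by
  have hZ := sum_exp_pos (fun k => β * G i k) i
  have hZle : ∑ k, Real.exp (β * G i k) ≤ n * Real.exp β := by
    calc ∑ k, Real.exp (β * G i k) ≤ ∑ _k : Fin n, Real.exp β :=
          Finset.sum_le_sum fun k _ => Real.exp_le_exp.2 (mul_le_of_le_one_right hβ (hG i k))
      _ = n * Real.exp β := by simp
  have hterm (k) : 0 ≤ Real.exp (β * G i k) * (G k j - G i k * G i j) := by
    have h1 := mul_le_of_le_one_left h0 (hG i k)
    exact mul_nonneg (Real.exp_pos _).le (by linarith [hmin k])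
  -- Minimality makes all terms nonnegative, so only `k = j` is kept, where `G j j = 1`.
  have hsum : 1 - G i j ≤ ∑ k, Real.exp (β * G i k) * (G k j - G i k * G i j) := by
    refine le_trans ?_ (Finset.single_le_sum (fun k _ => hterm k) (Finset.mem_univ j))
    rw [hdiag]
    have h1 := mul_le_of_le_one_left h0 (hG i j)
    have h2 : 1 ≤ Real.exp (β * G i j) := Real.one_le_exp (by positivity)
    nlinarith [hG i j]
  have h1 : 0 ≤ 1 - G i j := sub_nonneg.2 (hG i j)
  have hinv : Real.exp (-β) / n ≤ (∑ k, Real.exp (β * G i k))⁻¹ := by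
    rw [Real.exp_neg, div_eq_mul_inv, ← mul_inv, mul_comm]
    exact inv_anti₀ hZ hZle
  exact mul_le_mul hinv hsum h1 (inv_nonneg.2 hZ.le)

end Gram

/-! ### Growing and decaying bounds along trajectories. -/

section Comparison

variable {n d : ℕ} {β : ℝ} {x₀ : Fin n → UnitSphere d}
  {x : ℝ → Fin n → EuclideanSpace ℝ (Fin d)} {γ : ℝ → ℝ}

theorem IsSASolution.abs_inner_le_one (hx : IsSASolution β x₀ x) {t : ℝ} (ht : 0 ≤ t)
    (i j : Fin n) : |inner ℝ (x t i) (x t j)| ≤ 1 := by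
  simpa [hx.norm_eq_one ht] using abs_real_inner_le_norm (x t i) (x t j)

theorem IsSASolution.inner_self_eq_one (hx : IsSASolution β x₀ x) {t : ℝ} (ht : 0 ≤ t)
    (i : Fin n) : inner ℝ (x t i) (x t i) = 1 := by
  rw [real_inner_self_eq_norm_sq, hx.norm_eq_one ht, one_pow]

/-- Grönwall comparison of the Gram matrix with the mean-field correlation. -/
theorem abs_inner_sub_le_mul_cConst_rpow (hβ : 0 ≤ β) (hn : 2 ≤ n) (hx : IsSASolution β x₀ x)
    (hγ : IsGammaSolution β n γ) (hγ01 : ∀ t, 0 ≤ t → 0 ≤ γ t ∧ γ t ≤ 1) {ε : ℝ} (hε : 0 < ε)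
    (h0 : ∀ i j, i ≠ j → |inner ℝ (x₀ i : EuclideanSpace ℝ (Fin d)) (x₀ j)| ≤ ε) {t : ℝ}
    (ht : 0 ≤ t) {i j : Fin n} (hij : i ≠ j) :
    |inner ℝ (x t i) (x t j) - γ t| ≤ cConst β ^ ((n : ℝ) * t) * ε := by
  have hn' : (2 : ℝ) ≤ n := by exact_mod_cast hn
  set L : ℝ := 10 * max 1 β * n with hL
  -- The left side is the Lipschitz constant of the two drifts together; the strict inequality is
  -- what the barrier needs at contact.
  have hL' : 2 * (3 + 2 * β) < L := by
    have h1 : (1 : ℝ) ≤ max 1 β := le_max_left _ _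
    have h2 : β ≤ max 1 β := le_max_right _ _
    nlinarith
  -- The sign in `ℤˣ` encodes the absolute value as two one-sided families. Diagonal entries are
  -- included with zero error, so that the drift estimate has all entries at hand.
  let G : ℝ → Fin n → Fin n → ℝ := fun s a b => inner ℝ (x s a) (x s b)
  let f : Fin n × Fin n × ℤˣ → ℝ → ℝ := fun p s =>
    ((p.2.2 : ℤ) : ℝ) * (G s p.1 p.2.1 - equiangularGram (γ s) p.1 p.2.1)
  let f' : Fin n × Fin n × ℤˣ → ℝ → ℝ := fun p s =>
    ((p.2.2 : ℤ) : ℝ) * (gramDrift β (G s) p.1 p.2.1 + gramDrift β (G s) p.2.1 p.1 -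
      if p.1 = p.2.1 then gramDrift β (G s) p.1 p.2.1 + gramDrift β (G s) p.2.1 p.1
      else gammaField β n (γ s))
  have hdiag (a : Fin n) (s : ℝ) (hs : 0 ≤ s) : G s a a = 1 := hx.inner_self_eq_one hs a
  have hle (p : Fin n × Fin n × ℤˣ) : f p t ≤ Real.exp (L * t) * ε := by
    refine forall_le_of_hasDerivWithinAt_lt_at_contact (f' := f')
      (B := fun s => Real.exp (L * s) * ε) (B' := fun s => Real.exp (L * s) * L * ε) (a := 0)
      ?_ ?_ ?_ ?_ ht p
    · rintro ⟨a, b, σ⟩ s hs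
      refine HasDerivWithinAt.const_mul _ ?_
      by_cases hab : a = b
      · subst hab
        simp only [equiangularGram, if_true, sub_self]
        refine (hasDerivWithinAt_const s (Set.Ici 0) (0 : ℝ)).congr (fun r hr => ?_) ?_
        · rw [hdiag a r hr, sub_self]
        · rw [hdiag a s hs, sub_self]
      · simp only [equiangularGram, if_neg hab]
        exact (hx.hasDerivWithinAt_inner hs a b).sub (hγ.hasDeriv s hs)
    · intro s _
      have := ((((hasDerivAt_id s).const_mul L).exp).mul_const ε).hasDerivWithinAt
        (s := Set.Ici 0)
      simpa using this
    · rintro ⟨a, b, σ⟩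
      have h1 : |G 0 a b - equiangularGram (γ 0) a b| ≤ ε := by
        by_cases hab : a = b
        · subst hab
          simp only [equiangularGram, if_true, hdiag a 0 le_rfl, sub_self, abs_zero, hε.le]
        · simp only [equiangularGram, if_neg hab, hγ.initial, sub_zero, G, hx.initial]
          exact h0 a b hab
      rw [mul_zero, Real.exp_zero, one_mul]
      rcases Int.units_eq_one_or σ with rfl | rfl
      · simpa [f] using (abs_le.1 h1).2
      · simpa [f] using (neg_le_abs _).trans h1
    · rintro s hs hB ⟨a, b, σ⟩ heq
      have hBpos : 0 < Real.exp (L * s) * ε := by positivity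
      have hGH (k l : Fin n) : |G s k l - equiangularGram (γ s) k l| ≤ Real.exp (L * s) * ε := by
        refine abs_le.2 ⟨?_, by simpa [f] using hB (k, l, 1)⟩
        have : -(G s k l - equiangularGram (γ s) k l) ≤ Real.exp (L * s) * ε := by
          simpa [f] using hB (k, l, -1)
        linarith
      have hab : a ≠ b := by
        rintro rfl
        simp only [f, hdiag a s hs, equiangularGram, if_true, sub_self, mul_zero] at heq
        exact hBpos.ne heq
      obtain ⟨hγ0, hγ1⟩ := hγ01 s hs
      have hH (k l : Fin n) : |equiangularGram (γ s) k l| ≤ 1 := by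
        unfold equiangularGram
        split_ifs
        · simp
        · rwa [abs_of_nonneg hγ0]
      have hv (a b : Fin n) (hab : a ≠ b) (k : Fin n) :
          0 ≤ equiangularGram (γ s) k b - equiangularGram (γ s) a k * equiangularGram (γ s) a b ∧
          equiangularGram (γ s) k b - equiangularGram (γ s) a k * equiangularGram (γ s) a b
            ≤ 1 := by
        unfold equiangularGram
        rw [if_neg hab]
        split_ifs <;> constructor <;> nlinarith
      have hdrift (a b : Fin n) (hab : a ≠ b) :=
        abs_gramDrift_sub_le hβ (fun k l => hx.abs_inner_le_one hs k l) hH hGH (hv a b hab)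
      have h1 := hdrift a b hab
      have h2 := hdrift b a hab.symm
      rw [gramDrift_equiangularGram _ _ hab] at h1
      rw [gramDrift_equiangularGram _ _ hab.symm] at h2
      have hlt : |gramDrift β (G s) a b + gramDrift β (G s) b a - gammaField β n (γ s)|
          < Real.exp (L * s) * L * ε := by
        calc |gramDrift β (G s) a b + gramDrift β (G s) b a - gammaField β n (γ s)|
            ≤ 2 * (3 + 2 * β) * (Real.exp (L * s) * ε) := by
              rw [abs_le] at h1 h2 ⊢
              constructor <;> linarith
          _ < L * (Real.exp (L * s) * ε) := mul_lt_mul_of_pos_right hL' hBpos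
          _ = Real.exp (L * s) * L * ε := by ring
      simp only [f', if_neg hab]
      rcases Int.units_eq_one_or σ with rfl | rfl
      · simpa using (abs_lt.1 hlt).2
      · have := (neg_le_abs _).trans_lt hlt
        simpa using this
  have hc : cConst β ^ ((n : ℝ) * t) = Real.exp (L * t) := by
    rw [cConst, ← Real.exp_mul, hL, mul_assoc _ (n : ℝ)]
  have h1 := hle (i, j, 1)
  have h2 := hle (i, j, -1)
  simp only [f, G, equiangularGram, if_neg hij, Units.val_one, Int.cast_one, one_mul,
    Units.val_neg, Int.cast_neg, neg_mul] at h1 h2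
  rw [hc, abs_le]
  constructor <;> linarith

/-- Once all correlations are nonnegative, they converge to `1` exponentially fast. -/
theorem one_sub_inner_le_exp (hβ : 0 ≤ β) (hx : IsSASolution β x₀ x) {T : ℝ}
    (hT : 0 ≤ T) (hpos : ∀ i j, 0 ≤ inner ℝ (x T i) (x T j)) {t : ℝ} (ht : T ≤ t) (i j : Fin n) :
    1 - inner ℝ (x t i) (x t j) ≤ Real.exp (-(Real.exp (-β) / n) * (t - T)) := by
  have hn' : (0 : ℝ) < n := by
    exact_mod_cast i.pos
  set lam : ℝ := Real.exp (-β) / n with hlam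
  have hlampos : 0 < lam := by positivity
  let G : ℝ → Fin n → Fin n → ℝ := fun s a b => inner ℝ (x s a) (x s b)
  refine forall_le_of_hasDerivWithinAt_lt_at_contact (ι := Fin n × Fin n) (a := T)
    (f := fun p s => 1 - G s p.1 p.2)
    (f' := fun p s => -(gramDrift β (G s) p.1 p.2 + gramDrift β (G s) p.2 p.1))
    (B := fun s => Real.exp (-lam * (s - T)))
    (B' := fun s => Real.exp (-lam * (s - T)) * -lam) ?_ ?_ ?_ ?_ ht (i, j)
  · rintro ⟨a, b⟩ s hs
    exact ((hx.hasDerivWithinAt_inner (hT.trans hs) a b).const_sub 1).mono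
      (Set.Ici_subset_Ici.2 hT)
  · intro s _
    have := ((((hasDerivAt_id s).sub_const T).const_mul (-lam)).exp).hasDerivWithinAt
      (s := Set.Ici T)
    simpa using this
  · rintro ⟨a, b⟩
    simpa [G] using hpos a b
  · rintro s hs hB ⟨a, b⟩ heq
    have hs0 := hT.trans hs
    set B : ℝ := Real.exp (-lam * (s - T)) with hBdef
    have hBpos : 0 < B := Real.exp_pos _
    have hB1 : B ≤ 1 := Real.exp_le_one_iff.2 (by nlinarith)
    have hG1 (k l : Fin n) : G s k l ≤ 1 := (abs_le.1 (hx.abs_inner_le_one hs0 k l)).2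
    have hd (k : Fin n) : G s k k = 1 := hx.inner_self_eq_one hs0 k
    have hsymm : G s b a = G s a b := real_inner_comm _ _
    have heq' : 1 - G s a b = B := heq
    have hmin (k l : Fin n) : G s a b ≤ G s k l := by
      have : 1 - G s k l ≤ B := hB (k, l)
      linarith
    -- At contact the entry `(a, b)` is minimal. The motions of `a` and `b` contribute `lam * B`
    -- each, while the barrier decreases only at rate `lam * B`: strictness comes from this factor
    -- 2.
    have h1 := le_gramDrift_of_isMin hβ hG1 hd (i := a) (j := b) (by linarith)
      fun k => hmin k b
    have h2 := le_gramDrift_of_isMin hβ hG1 hd (i := b) (j := a) (by linarith)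
      fun k => hsymm ▸ hmin k a
    rw [hsymm] at h2
    rw [heq', ← hlam] at h1 h2
    have := mul_pos hlampos hBpos
    change -(gramDrift β (G s) a b + gramDrift β (G s) b a) < B * -lam
    linarith

theorem one_sub_gamma_le_exp (hβ : 0 ≤ β) (hn : 1 ≤ n) (hγ : IsGammaSolution β n γ)
    (hγ01 : ∀ t, 0 ≤ t → 0 ≤ γ t ∧ γ t ≤ 1) {t : ℝ} (ht : 0 ≤ t) :
    1 - γ t ≤ Real.exp (-(Real.exp (-β) / n) * t) := by
  have hn' : (0 : ℝ) < n := by exact_mod_cast hn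
  set lam : ℝ := Real.exp (-β) / n with hlam
  have hlampos : 0 < lam := by positivity
  refine forall_le_of_hasDerivWithinAt_lt_at_contact (ι := Unit) (a := 0)
    (f := fun _ s => 1 - γ s) (f' := fun _ s => -gammaField β n (γ s))
    (B := fun s => Real.exp (-lam * s)) (B' := fun s => Real.exp (-lam * s) * -lam)
    (fun _ s hs => (hγ.hasDeriv s hs).const_sub 1) ?_ (by simp [hγ.initial]) ?_ ht ()
  · intro s _
    have := (((hasDerivAt_id s).const_mul (-lam)).exp).hasDerivWithinAt (s := Set.Ici 0)
    simpa using this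
  · intro s hs _ _ heq
    have h1 := le_gammaField hβ hn (hγ01 s hs).1 (hγ01 s hs).2
    rw [heq, mul_div_assoc, ← hlam] at h1
    have := mul_pos hlampos (Real.exp_pos (-lam * s))
    linarith

end Comparison

/-! ### Assembly of the main theorem. -/

theorem mainTheorem1 (β : ℝ) (hβ : 0 ≤ β) (n : ℕ) (hn : 2 ≤ n) :
    ∃ γ : ℝ → ℝ,
      -- `γ` is the unique solution of the scalar Cauchy problem
      (IsGammaSolution β n γ ∧
        ∀ γ' : ℝ → ℝ, IsGammaSolution β n γ' → Set.EqOn γ' γ (Set.Ici 0)) ∧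
      ∃ dstar : ℕ, n ≤ dstar ∧ ∃ C : ℝ, 0 < C ∧ ∃ lam : ℝ, 0 < lam ∧
        ∀ d : ℕ, dstar ≤ d →
          -- the particle system has a unique solution for every initial datum
          (∀ x₀ : Fin n → UnitSphere d,
            ∃ x : ℝ → Fin n → EuclideanSpace ℝ (Fin d), IsSASolution β x₀ x ∧
              ∀ y : ℝ → Fin n → EuclideanSpace ℝ (Fin d), IsSASolution β x₀ y →
                Set.EqOn y x (Set.Ici 0)) ∧
          -- the estimate, for i.i.d. uniform initial points, with high probability
          ∀ {Ω : Type*} [MeasurableSpace Ω] (P : Measure Ω) [IsProbabilityMeasure P]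
            (X₀ : Fin n → Ω → UnitSphere d)
            (X : Ω → ℝ → Fin n → EuclideanSpace ℝ (Fin d)),
            (∀ i, Measurable (X₀ i)) →
            iIndepFun X₀ P →
            (∀ i, P.map (X₀ i) = uniformSphere d) →
            (∀ ω, IsSASolution β (fun i => X₀ i ω) (X ω)) →
            ∃ A : Set Ω, MeasurableSet A ∧
              1 - 2 * (n : ℝ) ^ 2 * (d : ℝ) ^ (-(1 / 64) : ℝ) ≤ P.real A ∧
              ∀ ω ∈ A, ∀ i j : Fin n, i ≠ j → ∀ t : ℝ, 0 ≤ t →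
                |inner ℝ (X ω t i) (X ω t j) - γ t| ≤
                  min (2 * cConst β ^ ((n : ℝ) * t) * √(Real.log d / d))
                    (C * Real.exp (-lam * t)) := by
  have hn1 : 1 ≤ n := by omega
  have hn0 : (0 : ℝ) < n := by exact_mod_cast hn1
  obtain ⟨γ, hγ, hγ01⟩ := exists_isGammaSolution hn1 β
  set lam : ℝ := Real.exp (-β) / n with hlam
  have hlampos : 0 < lam := by positivity
  have hγ1 : 0 < γ 1 := by
    have h1 := one_sub_gamma_le_exp hβ hn1 hγ hγ01 zero_le_one
    have h2 : Real.exp (-lam * 1) < 1 := Real.exp_lt_one_iff.2 (by linarith)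
    linarith
  have hlim : Filter.Tendsto (fun d : ℕ => cConst β ^ ((n : ℝ) * 1) * √(Real.log d / d))
      Filter.atTop (nhds 0) := by
    have h1 : Filter.Tendsto (fun d : ℕ => Real.log d / (d : ℝ)) Filter.atTop (nhds 0) :=
      Real.isLittleO_log_id_atTop.tendsto_div_nhds_zero.comp tendsto_natCast_atTop_atTop
    have h2 := (h1.sqrt).const_mul (cConst β ^ ((n : ℝ) * 1))
    rwa [Real.sqrt_zero, mul_zero] at h2
  -- From `d₁` on, the Grönwall error at time 1 is below `γ 1`.
  obtain ⟨d₁, hd₁⟩ := Filter.eventually_atTop.1 (hlim.eventually (gt_mem_nhds hγ1))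
  -- In `C = 2 * exp lam`, the factor `exp lam` pays for starting the decay at time 1, and 2 covers
  -- the trivial bound on the difference when `t ≤ 1`.
  refine ⟨γ, ⟨hγ, fun γ' hγ' => hγ.eqOn hn1 hγ'⟩, max n d₁, le_max_left _ _,
    2 * Real.exp lam, by positivity, lam, hlampos, fun d hd => ⟨fun x₀ => ?_, ?_⟩⟩
  · obtain ⟨x, hx⟩ := exists_isSASolution β x₀
    exact ⟨x, hx, fun y hy => hx.eqOn hy⟩
  intro Ω _ P _ X₀ X hmeas hind hunif hX
  have hd2 : 2 ≤ d := hn.trans ((le_max_left _ _).trans hd)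
  have hd1 : (1 : ℝ) < d := by exact_mod_cast hd2
  have hε : 0 < √(Real.log d / d) :=
    Real.sqrt_pos.2 (div_pos (Real.log_pos hd1) (by linarith))
  have hsmall := hd₁ d ((le_max_right _ _).trans hd)
  obtain ⟨A, hA, hPA, hAX⟩ := exists_measurableSet_abs_inner_le hd2 hmeas hind hunif
  refine ⟨A, hA, le_trans ?_ hPA, fun ω hω i j hij t ht => ?_⟩
  · have : (d : ℝ) ^ (-(1 / 2) : ℝ) ≤ (d : ℝ) ^ (-(1 / 64) : ℝ) :=
      Real.rpow_le_rpow_of_exponent_le hd1.le (by norm_num)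
    gcongr
  have hcomp {s : ℝ} (hs : 0 ≤ s) {a b : Fin n} (hab : a ≠ b) :=
    abs_inner_sub_le_mul_cConst_rpow hβ hn (hX ω) hγ hγ01 hε (hAX ω hω) hs hab
  refine le_min ?_ ?_
  · refine (hcomp ht hij).trans ?_
    have : 0 ≤ cConst β ^ ((n : ℝ) * t) := Real.rpow_nonneg (Real.exp_pos _).le _
    gcongr
    linarith
  have hg := abs_le.1 ((hX ω).abs_inner_le_one ht i j)
  have hγt := hγ01 t ht
  have hsplit : 2 * Real.exp lam * Real.exp (-lam * t) = 2 * Real.exp (-lam * (t - 1)) := by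
    rw [mul_assoc, ← Real.exp_add]
    ring_nf
  rw [hsplit]
  rcases le_total t 1 with h1 | h1
  · have : 1 ≤ Real.exp (-lam * (t - 1)) := Real.one_le_exp (by nlinarith)
    rw [abs_le]
    constructor <;> linarith
  · have hpos (a b : Fin n) : 0 ≤ inner ℝ (X ω 1 a) (X ω 1 b) := by
      by_cases hab : a = b
      · rw [hab]
        exact real_inner_self_nonneg
      · linarith [(abs_le.1 (hcomp zero_le_one hab)).1]
    have h2 := one_sub_inner_le_exp hβ (hX ω) zero_le_one hpos h1 i j
    have h3 := one_sub_gamma_le_exp hβ hn1 hγ hγ01 ht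
    have h4 : Real.exp (-lam * t) ≤ Real.exp (-lam * (t - 1)) :=
      Real.exp_le_exp.2 (by linarith)
    have h5 := Real.exp_pos (-lam * (t - 1))
    rw [abs_le]
    constructor <;> linarith
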